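/- Let $\Phi$ be an irreducible (finite, reduced, crystallographic) root system in a Euclidean space $V$, with Weyl group $W$, simple roots $\alpha_1,\dots,\alpha_n$, positive roots $\Phi^+$, root lattice $Q$, and weight lattice $P=\{v\in V:\langle v,\alpha^\vee\rangle\in\mathbb Z\text{ for all }\alpha\in\Phi\}$. Let $\omega_1,\dots,\omega_n$ be the fundamental weights, given by $\langle\omega_i,\alpha_j^\vee\rangle=\delta_{ij}$, and let $\rho=\omega_1+\dots+\omega_n$. A weight $\lambda \in P$ is dominant (strictly dominant) if $\langle\lambda,\alpha_i^\vee\rangle\ge0$ (respectively $>0$) for all $i$. For $\lambda\in P$ let $\Pi^Q(\lambda)=\{\mu\in \operatorname{ConvexHull}(W\lambda):\lambda-\mu\in Q\}$. A nonzero dominant weight $\lambda\in P$ is minuscule if $\Pi^Q(\lambda)=W\lambda$. Central-firing is the relation on $P$ given by $\lambda\to\lambda+\alpha$ whenever $\alpha\in\Phi^+$ and $\langle\lambda,\alpha^\vee\rangle=0$. Unlabeled central-firing is the induced relation on the set of orbits $P/W$: an orbit $A$ fires to an orbit $B$ if some $\lambda\in A$ and $\mu\in B$ satisfy $\lambda\to\mu$.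 For a relation $\to$ on a set, with reflexive transitive closure $\to^*$, an element $x$ has stabilization $y$ if $\to$ is terminating (it admits no infinite sequence of moves), $\to$ is confluent from $x$ (whenever $x\to^* z$ and $x\to^* z'$, there is $u$ with $z\to^* u$ and $z'\to^* u$), and $y$ is the unique element with $x\to^* y$ from which no move is possible. Let $\omega\in P$ be zero or minuscule. Then for every $\lambda\in\Pi^Q(\rho+\omega)$, the stabilization of $W\lambda$ under unlabeled central-firing is $W(\rho+\omega)$. Moreover, $\rho+\omega$ is the only strictly dominant weight in $\Pi^Q(\rho+\omega)$. -/

import Mathlib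

/-! Central-firing on the weight lattice of a root system, and on its quotient by the Weyl group.

A (finite, reduced, crystallographic) root system in a real vector space `V` is a Mathlib
`RootPairing ι ℝ V N` that is a root system; the coroot `α_i^∨` acts on `V` through `Φ.coroot' i`,
so `Φ.coroot' i v` is `⟨v, α_i^∨⟩`, which vanishes exactly when `v` is orthogonal to `α_i`. -/

namespace CentralFiring

noncomputable section

/-! ### Generalities on binary relations -/

section Relations

variable {X : Type*}

/-- There is no infinite sequence `x 0 → x 1 → x 2 → ⋯`. -/
def Terminating (r : X → X → Prop) : Prop :=
  ¬ ∃ x : ℕ → X, ∀ i, r (x i) (x (i + 1))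

/-- Any two elements reachable from `x` have a common element reachable from both. -/
def ConfluentFrom (r : X → X → Prop) (x : X) : Prop :=
  ∀ y y', Relation.ReflTransGen r x y → Relation.ReflTransGen r x y' →
    ∃ z, Relation.ReflTransGen r y z ∧ Relation.ReflTransGen r y' z

/-- No move is possible from `x`. -/
def Stable (r : X → X → Prop) (x : X) : Prop :=
  ¬ ∃ y, r x y

/-- `y` is the `r`-stabilization of `x`: the relation is terminating and confluent from `x`, and
`y` is the unique stable element that is reachable from `x`. -/
structure IsStabilization (r : X → X → Prop) (x y : X) : Prop where
  terminating : Terminating r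
  confluentFrom : ConfluentFrom r x
  reachable : Relation.ReflTransGen r x y
  stable : Stable r y
  unique : ∀ z, Relation.ReflTransGen r x z → Stable r z → z = y

end Relations

/-! ### Weights -/

variable {ι V N : Type*} [AddCommGroup V] [Module ℝ V] [AddCommGroup N] [Module ℝ N]

/-- The weight lattice: vectors whose pairing with every coroot is an integer. -/
def weightLattice (Φ : RootPairing ι ℝ V N) : AddSubgroup V where
  carrier := {v | ∀ i, ∃ n : ℤ, Φ.coroot' i v = n}
  zero_mem' i := ⟨0, by simp⟩
  add_mem' := by
    intro v w hv hw i
    obtain ⟨m, hm⟩ := hv i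
    obtain ⟨n, hn⟩ := hw i
    exact ⟨m + n, by rw [map_add, hm, hn]; push_cast; rfl⟩
  neg_mem' := by
    intro v hv i
    obtain ⟨m, hm⟩ := hv i
    exact ⟨-m, by rw [map_neg, hm]; push_cast; rfl⟩

theorem reflection_mem_weightLattice (Φ : RootPairing ι ℝ V N) (i : ι) {v : V}
    (hv : v ∈ weightLattice Φ) : Φ.reflection i v ∈ weightLattice Φ := by
  intro j
  obtain ⟨n, hn⟩ := hv (Φ.reflectionPerm i j)
  refine ⟨n, ?_⟩
  rw [← hn]
  simp only [RootPairing.coroot', LinearMap.flip_apply, RootPairing.reflection_apply,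
    RootPairing.coroot_reflectionPerm, RootPairing.coreflection_apply, map_sub, map_smul,
    LinearMap.sub_apply, LinearMap.smul_apply, smul_eq_mul]
  ring

theorem smul_mem_weightLattice (Φ : RootPairing ι ℝ V N) (w : Φ.weylGroup) :
    ∀ {v : V}, v ∈ weightLattice Φ → w • v ∈ weightLattice Φ := by
  obtain ⟨w, hw⟩ := w
  induction hw using RootPairing.weylGroup.induction with
  | mem i => exact fun hv => reflection_mem_weightLattice Φ i hv
  | one => exact fun hv => hv
  | mul x y hx hy ihx ihy => exact fun hv => ihx (ihy hv)

/-- The action of the Weyl group on the weight lattice. -/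
instance (Φ : RootPairing ι ℝ V N) : MulAction Φ.weylGroup (weightLattice Φ) where
  smul w v := ⟨w • (v : V), smul_mem_weightLattice Φ w v.2⟩
  one_smul v := Subtype.ext (one_smul Φ.weylGroup (v : V))
  mul_smul w w' v := Subtype.ext (mul_smul w w' (v : V))

/-- The root lattice: integer combinations of roots. -/
def rootLattice (Φ : RootPairing ι ℝ V N) : AddSubgroup V :=
  AddSubgroup.closure (Set.range Φ.root)

/-- The permutohedron of `v`: the convex hull of the Weyl group orbit of `v`. -/
def permutohedron (Φ : RootPairing ι ℝ V N) (v : V) : Set V :=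
  convexHull ℝ (MulAction.orbit Φ.weylGroup v)

/-- The lattice points of the permutohedron of `v`: those in the same coset of the root lattice. -/
def latticePoints (Φ : RootPairing ι ℝ V N) (v : V) : Set V :=
  {u | u ∈ permutohedron Φ v ∧ v - u ∈ rootLattice Φ}

variable {Φ : RootPairing ι ℝ V N}

/-- Nonnegative pairing with every simple coroot. -/
def Dominant (b : Φ.Base) (v : V) : Prop :=
  ∀ i ∈ b.support, 0 ≤ Φ.coroot' i v

/-- Positive pairing with every simple coroot. -/
def StrictlyDominant (b : Φ.Base) (v : V) : Prop :=
  ∀ i ∈ b.support, 0 < Φ.coroot' i v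

/-- A nonzero dominant weight whose permutohedron has no lattice points other than the elements of
its Weyl group orbit. -/
structure Minuscule (b : Φ.Base) (v : V) : Prop where
  mem_weightLattice : v ∈ weightLattice Φ
  ne_zero : v ≠ 0
  dominant : Dominant b v
  latticePoints_eq : latticePoints Φ v = MulAction.orbit Φ.weylGroup v

/-- The fundamental weight of a simple root: the dual basis of the basis of simple coroots. -/
def fundamentalWeight [Φ.IsRootSystem] (b : Φ.Base) (i : b.support) : V :=
  Φ.toLinearMap.toPerfPair.symm (b.toCoweightBasis.coord i)

theorem coroot'_fundamentalWeight [Φ.IsRootSystem] [DecidableEq ι] (b : Φ.Base)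
    (i j : b.support) : Φ.coroot' j (fundamentalWeight b i) = if i = j then 1 else 0 := by
  have h : Φ.coroot' j (fundamentalWeight b i) =
      b.toCoweightBasis.coord i (Φ.coroot j) := by
    rw [fundamentalWeight, RootPairing.coroot', LinearMap.flip_apply,
      LinearMap.apply_symm_toPerfPair_self]
  rw [h, Module.Basis.coord_apply, RootPairing.Base.toCoweightBasis_repr_coroot,
    Finsupp.single_apply]
  simp only [eq_comm]

/-- The Weyl vector `ρ`: the sum of the fundamental weights. -/
def weylVector [Φ.IsRootSystem] (b : Φ.Base) : V :=
  ∑ i : b.support, fundamentalWeight b i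

theorem coroot'_weylVector [Φ.IsRootSystem] (b : Φ.Base) {i : ι} (hi : i ∈ b.support) :
    Φ.coroot' i (weylVector b) = 1 := by
  classical
  rw [weylVector, map_sum]
  have h : ∀ j : b.support, Φ.coroot' i (fundamentalWeight b j) =
      if j = ⟨i, hi⟩ then 1 else 0 := fun j => coroot'_fundamentalWeight b j ⟨i, hi⟩
  simp [h]

theorem weylVector_mem_weightLattice [Φ.IsRootSystem] (b : Φ.Base) :
    weylVector b ∈ weightLattice Φ := by
  intro i
  have hi := b.coroot_mem_span_int i
  change ∃ n : ℤ, Φ.toLinearMap (weylVector b) (Φ.coroot i) = n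
  generalize Φ.coroot i = c at hi ⊢
  induction hi using Submodule.span_induction with
  | mem x hx =>
    obtain ⟨j, hj, rfl⟩ := hx
    exact ⟨1, by simpa using coroot'_weylVector b (Finset.mem_coe.mp hj)⟩
  | zero => exact ⟨0, by simp⟩
  | add x y _ _ hx hy =>
    obtain ⟨m, hm⟩ := hx
    obtain ⟨n, hn⟩ := hy
    exact ⟨m + n, by rw [map_add, hm, hn]; push_cast; rfl⟩
  | smul a x _ hx =>
    obtain ⟨m, hm⟩ := hx
    exact ⟨a * m, by rw [map_zsmul, hm, zsmul_eq_mul]; push_cast; rfl⟩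

/-- The Weyl vector as an element of the weight lattice. -/
def rho [Φ.IsRootSystem] (b : Φ.Base) : weightLattice Φ :=
  ⟨weylVector b, weylVector_mem_weightLattice b⟩

/-! ### Central-firing -/

/-- Central-firing on the weight lattice: `v → v + α` whenever `α` is a positive root that is
orthogonal to `v`. -/
def CentralFires (b : Φ.Base) (v v' : weightLattice Φ) : Prop :=
  ∃ i, b.IsPos i ∧ Φ.coroot' i (v : V) = 0 ∧ (v' : V) = (v : V) + Φ.root i

/-- The set of Weyl group orbits on the weight lattice. -/
abbrev WeightOrbits (Φ : RootPairing ι ℝ V N) : Type _ :=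
  MulAction.orbitRel.Quotient Φ.weylGroup (weightLattice Φ)

/-- The Weyl group orbit of a weight. -/
def weightOrbit (v : weightLattice Φ) : WeightOrbits Φ :=
  Quotient.mk (MulAction.orbitRel Φ.weylGroup (weightLattice Φ)) v

/-- Unlabeled central-firing: the relation on Weyl group orbits of weights under which one orbit
fires to another if some element of the first centrally fires to some element of the second. -/
def UnlabeledCentralFires (b : Φ.Base) (A B : WeightOrbits Φ) : Prop :=
  ∃ v v' : weightLattice Φ, weightOrbit v = A ∧ weightOrbit v' = B ∧ CentralFires b v v'

end

end CentralFiring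

namespace CentralFiring

open RootPairing

variable {ι V N : Type*} [AddCommGroup V] [Module ℝ V] [AddCommGroup N] [Module ℝ N]
variable {Φ : RootPairing ι ℝ V N}

/-! ### The Weyl group -/

/-! The permutohedron of a dominant weight `μ` is cut out by the order of the cone spanned by the
simple roots: it is the set of `u` with `μ - w • u` in that cone for every `w` in the Weyl group
(`dominatedSet`). The heart of the proof is that this set is a trap when `μ` is a strictly dominant
weight: a firing from `u` in the root-lattice coset of `μ` cannot leave it
(`add_root_mem_dominatedSet`). The key estimate is `exists_le_repr_sub`: if `u` is orthogonal to a
root `β` with `i`-th coefficient `p`, then the `i`-th coefficient of `μ - u` is at least `p / 2`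
times the value of `μ` on some positive coroot, plus a nonnegative term. A value of at least 2 there
leaves room to subtract `β`; the value 1 needs integrality and a bound on Cartan integers, with `G₂`
treated apart.

Firing `v → v + α` with `v` orthogonal to `α` raises the invariant form `RootForm v v` by at least
4, while a large multiple of `ρ` provides a trap in which the form is bounded; hence termination
(`terminating_unlabeledCentralFires`).

An orbit is stable exactly when it contains a strictly dominant weight. If such a `v` lies below `ρ
+ ω` in the same coset, then `v - ρ` is dominant and is a lattice point of the permutohedron of `ω`,
so it is in the orbit of `ω` and equals `ω`. The trap thus holds a single stable orbit, and with
termination this gives confluence and the stabilization. -/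

theorem root_weylGroup_smul (w : Φ.weylGroup) (i : ι) : Φ.root (w • i) = w • Φ.root i :=
  Equiv.root_indexEquiv_eq_smul Φ i (w : Φ.Aut)

theorem coroot'_weylGroup_smul (w : Φ.weylGroup) :
    ∀ (i : ι) (v : V), Φ.coroot' (w • i) (w • v) = Φ.coroot' i v := by
  obtain ⟨w, hw⟩ := w
  induction hw using RootPairing.weylGroup.induction with
  | mem j =>
    intro i v
    change Φ.coroot' (Φ.reflectionPerm j i) (Φ.reflection j v) = _
    rw [RootPairing.coroot'_reflection, RootPairing.reflectionPerm_self]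
  | one => exact fun i v => rfl
  | mul x y hx hy ihx ihy => exact fun i v => (ihx _ _).trans (ihy i v)

theorem coroot'_smul_right (w : Φ.weylGroup) (i : ι) (v : V) :
    Φ.coroot' i (w • v) = Φ.coroot' (w⁻¹ • i) v := by
  rw [← coroot'_weylGroup_smul w (w⁻¹ • i), smul_inv_smul]

theorem ofIdx_smul_eq (i : ι) (v : V) :
    weylGroup.ofIdx Φ i • v = v - Φ.coroot' i v • Φ.root i :=
  Φ.reflection_apply i v

theorem ofIdx_smul_idx (i j : ι) : weylGroup.ofIdx Φ i • j = Φ.reflectionPerm i j := rfl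

theorem ofIdx_smul_smul (i : ι) (v : V) :
    weylGroup.ofIdx Φ i • weylGroup.ofIdx Φ i • v = v :=
  Φ.reflection_same i v

theorem ofIdx_smul_conj (w : Φ.weylGroup) (i : ι) (v : V) :
    weylGroup.ofIdx Φ (w • i) • w • v = w • weylGroup.ofIdx Φ i • v := by
  rw [ofIdx_smul_eq, ofIdx_smul_eq, coroot'_weylGroup_smul, root_weylGroup_smul, smul_sub,
    smul_comm w]

/-- The linear map by which an element of the Weyl group acts. -/
noncomputable abbrev weylMap (w : Φ.weylGroup) : V →ₗ[ℝ] V := DistribSMul.toLinearMap ℝ V w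

theorem finite_weylGroup [Finite ι] [Φ.IsRootSystem] : Finite Φ.weylGroup := by
  refine Finite.of_injective (fun w : Φ.weylGroup => MulAction.toPerm (α := Φ.weylGroup) (β := ι) w) ?_
  intro w w' h
  refine Subtype.ext (Equiv.weightHom_injective Φ (LinearEquiv.toLinearMap_injective ?_))
  refine LinearMap.ext_on_range (v := Φ.root) IsRootSystem.span_root_eq_top fun i => ?_
  change w • Φ.root i = w' • Φ.root i
  rw [← root_weylGroup_smul, ← root_weylGroup_smul]
  exact congrArg Φ.root (DFunLike.congr_fun h i)

/-! ### Words in the simple reflections -/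

/-- The product of the reflections in a list of roots. -/
noncomputable def wordProd (l : List ι) : Φ.weylGroup := (l.map (weylGroup.ofIdx Φ)).prod

@[simp] theorem wordProd_nil : wordProd (Φ := Φ) [] = 1 := rfl

@[simp] theorem wordProd_cons (i : ι) (l : List ι) :
    wordProd (Φ := Φ) (i :: l) = weylGroup.ofIdx Φ i * wordProd l := by simp [wordProd]

@[simp] theorem wordProd_append (l l' : List ι) :
    wordProd (Φ := Φ) (l ++ l') = wordProd l * wordProd l' := by simp [wordProd]

variable [Finite ι] [Φ.IsRootSystem] [Φ.IsCrystallographic] [Φ.IsReduced] (b : Φ.Base)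

omit [Φ.IsRootSystem] in
/-- The exchange property. -/
theorem isPos_wordProd_smul_or_exists (i : ι) (hi : i ∈ b.support) (l : List ι)
    (hl : ∀ j ∈ l, j ∈ b.support) :
    b.IsPos (wordProd (Φ := Φ) l • i) ∨
      ∃ l' : List ι, (∀ j ∈ l', j ∈ b.support) ∧ l'.length < l.length ∧
        ∀ v : V, wordProd (Φ := Φ) l' • v = wordProd (Φ := Φ) l • weylGroup.ofIdx Φ i • v := by
  induction l with
  | nil => exact Or.inl (by simpa using RootPairing.Base.isPos_of_mem_support hi)
  | cons a l ih =>
    have ha : a ∈ b.support := hl a (by simp)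
    have hl' : ∀ j ∈ l, j ∈ b.support := fun j hj => hl j (by simp [hj])
    rcases ih hl' with h | ⟨l', h₁, h₂, h₃⟩
    -- If the word `l` carries the simple root `i` to `a`, conjugation shows that multiplying `a ::
    -- l` by the reflection in `i` deletes `a`. Otherwise the simple reflection in `a` keeps the
    -- root positive, since it permutes the positive roots other than `a`.
    · by_cases hja : wordProd (Φ := Φ) l • i = a
      · refine Or.inr ⟨l, hl', by simp, fun v => ?_⟩
        rw [wordProd_cons, mul_smul, ← hja, ofIdx_smul_conj, ofIdx_smul_smul]
      · left
        rw [wordProd_cons, mul_smul, ofIdx_smul_idx]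
        exact h.reflectionPerm ha hja
    · refine Or.inr ⟨a :: l', ?_, by simpa using h₂, fun v => ?_⟩
      · simpa [ha] using h₁
      · rw [wordProd_cons, wordProd_cons, mul_smul, mul_smul, h₃]

omit [Φ.IsRootSystem] in
-- Every root is reached from a simple one by simple reflections and sign changes; its reflection is
-- then a conjugate of a simple reflection, opposite roots having the same reflection.
theorem exists_wordProd_smul_eq (w : Φ.weylGroup) :
    ∃ l : List ι, (∀ j ∈ l, j ∈ b.support) ∧ ∀ v : V, w • v = wordProd (Φ := Φ) l • v := by
  obtain ⟨w, hw⟩ := w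
  induction hw using RootPairing.weylGroup.induction with
  | mem i =>
    change ∃ l : List ι, _ ∧ ∀ v : V, weylGroup.ofIdx Φ i • v = _
    refine b.induction_reflect i
      (p := fun i => ∃ l : List ι, (∀ j ∈ l, j ∈ b.support) ∧
        ∀ v : V, weylGroup.ofIdx Φ i • v = wordProd (Φ := Φ) l • v) ?_ ?_ ?_
    · rintro i ⟨l, h₁, h₂⟩
      refine ⟨l, h₁, fun v => ?_⟩
      rw [← h₂, ← ofIdx_smul_idx]
      nth_rw 1 [← ofIdx_smul_smul (Φ := Φ) i v]
      rw [ofIdx_smul_conj, ofIdx_smul_smul]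
    · exact fun i hi => ⟨[i], by simpa using hi, fun v => by simp⟩
    · rintro i j ⟨l, h₁, h₂⟩ hj
      refine ⟨j :: l ++ [j], ?_, fun v => ?_⟩
      · intro k hk
        simp only [List.cons_append, List.mem_cons, List.mem_append, List.not_mem_nil,
          or_false] at hk
        rcases hk with rfl | hk | rfl
        exacts [hj, h₁ k hk, hj]
      · rw [← ofIdx_smul_idx]
        nth_rw 1 [← ofIdx_smul_smul (Φ := Φ) j v]
        rw [ofIdx_smul_conj, h₂]
        simp [mul_smul]
  | one => exact ⟨[], by simp, fun v => rfl⟩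
  | mul x y hx hy ihx ihy =>
    obtain ⟨l, h₁, h₂⟩ := ihx
    obtain ⟨l', h₁', h₂'⟩ := ihy
    refine ⟨l ++ l', ?_, fun v => ?_⟩
    · intro j hj
      rcases List.mem_append.mp hj with hj | hj
      exacts [h₁ j hj, h₁' j hj]
    · rw [wordProd_append, mul_smul, ← h₂', ← h₂]
      rfl

/-! ### The cone spanned by the simple roots -/

omit [Finite ι] [Φ.IsCrystallographic] [Φ.IsReduced]

/-- Being a combination of simple roots with nonnegative real coefficients. -/
def InRootCone (v : V) : Prop := ∀ i : b.support, 0 ≤ b.toWeightBasis.repr v i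

variable {b}

theorem InRootCone.zero : InRootCone b 0 := fun i => by simp

theorem InRootCone.add {u v : V} (hu : InRootCone b u) (hv : InRootCone b v) :
    InRootCone b (u + v) := fun i => by
  simpa using add_nonneg (hu i) (hv i)

theorem InRootCone.smul {c : ℝ} (hc : 0 ≤ c) {v : V} (hv : InRootCone b v) :
    InRootCone b (c • v) := fun i => by
  simpa using mul_nonneg hc (hv i)

theorem InRootCone.sum {α : Type*} {s : Finset α} {f : α → V}
    (h : ∀ a ∈ s, InRootCone b (f a)) : InRootCone b (∑ a ∈ s, f a) := fun i => by
  simpa using Finset.sum_nonneg fun a ha => h a ha i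

theorem InRootCone.root {i : ι} (hi : b.IsPos i) : InRootCone b (Φ.root i) := by
  classical
  have key : ∀ x ∈ AddSubmonoid.closure (Φ.root '' b.support), InRootCone b x := by
    intro x hx
    induction hx using AddSubmonoid.closure_induction with
    | mem x hx =>
      obtain ⟨j, hj, rfl⟩ := hx
      intro k
      rw [b.toWeightBasis_repr_root ⟨j, hj⟩, Finsupp.single_apply]
      split_ifs <;> simp
    | zero => exact InRootCone.zero
    | add x y _ _ hx hy => exact hx.add hy
  rcases b.root_mem_or_neg_mem i with h | h
  · exact key _ h
  · exfalso
    obtain ⟨f, -, -, hf⟩ := b.exists_root_eq_sum_int i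
    have hpos : 0 < b.height i := hi
    rw [RootPairing.Base.height_eq_sum hf] at hpos
    -- Positivity of a root is positivity of its height, so some simple coefficient is positive,
    -- which excludes the opposite sign pattern.
    obtain ⟨j, hj, hj'⟩ := Finset.exists_lt_of_sum_lt (s := b.support) (f := fun _ => (0 : ℤ))
      (g := f) (by simpa using hpos)
    have := key _ h ⟨j, hj⟩
    rw [hf, ← Finset.sum_coe_sort] at this
    simp only [← Int.cast_smul_eq_zsmul ℝ, map_neg, map_sum, map_smul, Finsupp.neg_apply,
      Finsupp.coe_finsetSum, Finset.sum_apply, Finsupp.smul_apply,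
      RootPairing.Base.toWeightBasis_repr_root, Finsupp.single_apply, smul_eq_mul] at this
    simp only [mul_ite, mul_one, mul_zero, Finset.sum_ite_eq', Finset.mem_univ, if_true] at this
    have h' : (0 : ℝ) < f j := by exact_mod_cast hj'
    linarith

theorem InRootCone.map_nonneg {v : V} (hv : InRootCone b v) (f : V →ₗ[ℝ] ℝ)
    (hf : ∀ i ∈ b.support, 0 ≤ f (Φ.root i)) : 0 ≤ f v := by
  rw [← b.toWeightBasis.sum_repr v, map_sum]
  exact Finset.sum_nonneg fun i _ => by
    rw [map_smul, RootPairing.Base.toWeightBasis_apply]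
    exact mul_nonneg (hv i) (hf i i.2)

theorem eq_of_inRootCone_sub {u v : V} (h : InRootCone b (u - v)) (h' : InRootCone b (v - u)) :
    u = v := by
  refine b.toWeightBasis.repr.injective (Finsupp.ext fun i => le_antisymm ?_ ?_)
  · simpa using h' i
  · simpa using h i

variable [Finite ι] [Φ.IsCrystallographic] [Φ.IsReduced]

/-- Induction on the length of a word: `v - w sᵢ v` is `v - w v` plus a nonnegative multiple of the
root `w αᵢ`. If that root is not positive, exchange provides a shorter word for `w sᵢ`. -/
theorem Dominant.inRootCone_sub_smul {v : V} (hv : Dominant b v) (w : Φ.weylGroup) :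
    InRootCone b (v - w • v) := by
  obtain ⟨l, hl, hw⟩ := exists_wordProd_smul_eq b w
  rw [hw]
  clear hw
  generalize hn : l.length = n
  induction n using Nat.strong_induction_on generalizing l with
  | _ n ih =>
    rcases List.eq_nil_or_concat l with rfl | ⟨l, i, rfl⟩
    · simpa using InRootCone.zero
    · rw [List.concat_eq_append] at hl hn ⊢
      have hi : i ∈ b.support := hl i (by simp)
      have hl' : ∀ j ∈ l, j ∈ b.support := fun j hj => hl j (by simp [hj])
      rcases isPos_wordProd_smul_or_exists b i hi l hl' with h | ⟨l', h₁, h₂, h₃⟩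
      · have := (ih l.length (by simp at hn; omega) l hl' rfl).add
          ((InRootCone.root h).smul (hv i hi))
        convert this using 1
        rw [wordProd_append, mul_smul, root_weylGroup_smul]
        simp only [wordProd_cons, wordProd_nil, mul_one, ofIdx_smul_eq, smul_sub]
        rw [smul_comm (wordProd (Φ := Φ) l)]
        abel
      · have := ih l'.length (by simp at hn; omega) l' h₁ rfl
        rw [h₃] at this
        simpa [mul_smul] using this

end CentralFiring

namespace CentralFiring

open RootPairing

variable {ι V N : Type*} [AddCommGroup V] [Module ℝ V] [AddCommGroup N] [Module ℝ N]
variable {Φ : RootPairing ι ℝ V N}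
variable [Φ.IsRootSystem] {b : Φ.Base}

/-! ### Simple roots, fundamental weights and dominance -/

theorem sum_coroot'_smul_fundamentalWeight (b : Φ.Base) (v : V) :
    ∑ i : b.support, Φ.coroot' i v • fundamentalWeight b i = v := by
  classical
  have h : ∀ c : N, Φ.toLinearMap (∑ i : b.support, Φ.coroot' i v • fundamentalWeight b i) c =
      Φ.toLinearMap v c := by
    intro c
    have : Φ.toLinearMap (∑ i : b.support, Φ.coroot' i v • fundamentalWeight b i) =
        Φ.toLinearMap v := by
      refine b.toCoweightBasis.ext fun j => ?_
      rw [RootPairing.Base.toCoweightBasis_apply]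
      change Φ.coroot' j _ = Φ.coroot' j v
      simp only [map_sum, map_smul, coroot'_fundamentalWeight, smul_eq_mul, mul_ite, mul_one,
        mul_zero, Finset.sum_ite_eq', Finset.mem_univ, if_true]
    rw [this]
  exact Φ.toPerfPair.injective (LinearMap.ext h)

theorem dominant_fundamentalWeight (b : Φ.Base) (i : b.support) :
    Dominant b (fundamentalWeight b i) := by
  classical
  intro j hj
  have := coroot'_fundamentalWeight b i ⟨j, hj⟩
  simp only at this
  rw [this]
  split_ifs <;> simp

omit [Φ.IsRootSystem] in
theorem StrictlyDominant.dominant {v : V} (hv : StrictlyDominant b v) : Dominant b v :=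
  fun i hi => (hv i hi).le

theorem ofIdx_smul_weylVector {i : ι} (hi : i ∈ b.support) :
    weylGroup.ofIdx Φ i • weylVector b = weylVector b - Φ.root i := by
  rw [ofIdx_smul_eq, coroot'_weylVector b hi, one_smul]

/-- Every linear functional becomes dominant after the action of some element of the Weyl group. -/
theorem exists_forall_nonneg_apply_smul_root [Finite ι] (b : Φ.Base) (f : V →ₗ[ℝ] ℝ) :
    ∃ w : Φ.weylGroup, ∀ i ∈ b.support, 0 ≤ f (w • Φ.root i) := by
  have := finite_weylGroup (Φ := Φ)
  -- Maximality at `w` against `w sᵢ` gives the inequality, because `sᵢ ρ = ρ - αᵢ`.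
  obtain ⟨w, hw⟩ := Finite.exists_max fun w : Φ.weylGroup => f (w • weylVector b)
  refine ⟨w, fun i hi => ?_⟩
  have := hw (w * weylGroup.ofIdx Φ i)
  rw [mul_smul, ofIdx_smul_weylVector hi, smul_sub, map_sub] at this
  linarith

/-! ### The invariant form -/

section Form

variable [Fintype ι]

omit [Φ.IsRootSystem] in
theorem rootForm_weylGroup_smul (w : Φ.weylGroup) (u v : V) :
    Φ.RootForm (w • u) (w • v) = Φ.RootForm u v := by
  simp only [RootPairing.rootForm_apply_apply, coroot'_smul_right]
  exact Fintype.sum_equiv (MulAction.toPerm w⁻¹) _ _ fun i => rfl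

omit [Φ.IsRootSystem] in
theorem rootForm_comm (u v : V) : Φ.RootForm u v = Φ.RootForm v u := by
  simp only [RootPairing.rootForm_apply_apply, mul_comm]

omit [Φ.IsRootSystem] in
theorem two_mul_rootForm_root (v : V) (i : ι) :
    2 * Φ.RootForm v (Φ.root i) = Φ.coroot' i v * Φ.RootForm (Φ.root i) (Φ.root i) := by
  have h := congrArg (Φ.toLinearMap v) (Φ.rootForm_self_smul_coroot i)
  rw [map_smul, map_nsmul, RootPairing.toLinearMap_apply_apply_Polarization, rootForm_comm (Φ.root i) v] at h
  rw [RootPairing.coroot', LinearMap.flip_apply, mul_comm (Φ.toLinearMap v _)]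
  simpa using h.symm

omit [Φ.IsRootSystem] in
theorem four_le_rootForm_root_self (i : ι) : 4 ≤ Φ.RootForm (Φ.root i) (Φ.root i) := by
  rw [RootPairing.rootForm_apply_apply]
  have := Finset.single_le_sum (f := fun j => Φ.coroot' j (Φ.root i) * Φ.coroot' j (Φ.root i))
    (fun j _ => mul_self_nonneg _) (Finset.mem_univ i)
  simp only [RootPairing.root_coroot'_eq_pairing, RootPairing.pairing_same] at this ⊢
  linarith

theorem Dominant.rootForm_nonneg {u v : V} (hu : Dominant b u) (hv : InRootCone b v) :
    0 ≤ Φ.RootForm u v := by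
  refine hv.map_nonneg (Φ.RootForm u) fun i hi => ?_
  have h := two_mul_rootForm_root (Φ := Φ) u i
  have := mul_nonneg (hu i hi) ((by norm_num : (0 : ℝ) ≤ 4).trans (four_le_rootForm_root_self (Φ := Φ) i))
  linarith

theorem Dominant.rootForm_self_le {u v : V} (hu : Dominant b u) (hv : Dominant b v)
    (h : InRootCone b (v - u)) : Φ.RootForm u u ≤ Φ.RootForm v v := by
  have h₁ := hu.rootForm_nonneg h
  have h₂ := hv.rootForm_nonneg h
  rw [map_sub] at h₁ h₂
  rw [rootForm_comm v u] at h₂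
  linarith

end Form

/-! ### Dominant representatives and positive coroots -/

variable [Finite ι]

theorem exists_dominant_smul (b : Φ.Base) (v : V) : ∃ w : Φ.weylGroup, Dominant b (w • v) := by
  cases nonempty_fintype ι
  obtain ⟨w, hw⟩ := exists_forall_nonneg_apply_smul_root b (Φ.RootForm v)
  refine ⟨w⁻¹, fun i hi => ?_⟩
  have h := two_mul_rootForm_root (Φ := Φ) v (w • i)
  have h₁ := four_le_rootForm_root_self (Φ := Φ) (w • i)
  have h₂ := hw i hi
  rw [← root_weylGroup_smul] at h₂
  rw [coroot'_smul_right, inv_inv]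
  by_contra! hneg
  have := mul_neg_of_neg_of_pos hneg (by linarith : 0 < Φ.RootForm (Φ.root (w • i)) _)
  linarith

/-- Positivity is defined through roots and has to be transferred to coroots. The invariant form
does this: a root and its coroot pair with `ρ` with the same sign. -/
theorem coroot_mem_closure_of_isPos {i : ι} (hi : b.IsPos i) :
    Φ.coroot i ∈ AddSubmonoid.closure (Φ.coroot '' b.support) := by
  cases nonempty_fintype ι
  refine (b.coroot_mem_or_neg_mem i).resolve_right fun h => ?_
  have key : ∀ x ∈ AddSubmonoid.closure (Φ.coroot '' b.support),
      x = 0 ∨ 0 < Φ.toLinearMap (weylVector b) x := by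
    intro x hx
    induction hx using AddSubmonoid.closure_induction with
    | mem x hx =>
      obtain ⟨j, hj, rfl⟩ := hx
      right
      change 0 < Φ.coroot' j (weylVector b)
      rw [coroot'_weylVector b hj]
      exact one_pos
    | zero => exact Or.inl rfl
    | add x y _ _ hx hy =>
      rcases hx with rfl | hx
      · simpa using hy
      · rcases hy with rfl | hy
        · simpa using Or.inr hx
        · exact Or.inr (by rw [map_add]; exact add_pos hx hy)
  have hρ : Dominant b (weylVector b) := fun j hj => by
    rw [coroot'_weylVector b hj]; exact zero_le_one
  rcases key _ h with h | h
  · exact Φ.ne_zero' i (neg_eq_zero.mp h)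
  · have h₁ := hρ.rootForm_nonneg (InRootCone.root hi)
    have h₂ := two_mul_rootForm_root (Φ := Φ) (weylVector b) i
    have h₃ := four_le_rootForm_root_self (Φ := Φ) i
    rw [map_neg] at h
    have h₄ : Φ.coroot' i (weylVector b) < 0 := by
      change Φ.toLinearMap (weylVector b) (Φ.coroot i) < 0
      linarith
    have := mul_neg_of_neg_of_pos h₄ (by linarith : 0 < Φ.RootForm (Φ.root i) (Φ.root i))
    linarith

/-- A lower bound for the values of a vector on the simple coroots is a lower bound for its
values on all positive coroots; twice the bound holds for positive coroots that are not simple. -/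
theorem le_coroot'_of_isPos {c : ℝ} (hc : 0 ≤ c) {v : V}
    (hv : ∀ i ∈ b.support, c ≤ Φ.coroot' i v) {i : ι} (hi : b.IsPos i) :
    (i ∈ b.support ∧ c ≤ Φ.coroot' i v) ∨ 2 * c ≤ Φ.coroot' i v := by
  have key : ∀ x ∈ AddSubmonoid.closure (Φ.coroot '' b.support),
      x = 0 ∨ (x ∈ Φ.coroot '' b.support ∧ c ≤ Φ.toLinearMap v x) ∨
        2 * c ≤ Φ.toLinearMap v x := by
    intro x hx
    induction hx using AddSubmonoid.closure_induction with
    | mem x hx =>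
      refine Or.inr (Or.inl ⟨hx, ?_⟩)
      obtain ⟨j, hj, rfl⟩ := hx
      exact hv j hj
    | zero => exact Or.inl rfl
    | add x y _ _ hx hy =>
      rcases hx with rfl | hx
      · simpa using hy
      · rcases hy with rfl | hy
        · simpa using Or.inr hx
        · have hx' : c ≤ Φ.toLinearMap v x := by rcases hx with ⟨-, h⟩ | h <;> linarith
          have hy' : c ≤ Φ.toLinearMap v y := by rcases hy with ⟨-, h⟩ | h <;> linarith
          exact Or.inr (Or.inr (by rw [map_add]; linarith))
  rcases key _ (coroot_mem_closure_of_isPos hi) with h | ⟨⟨j, hj, hji⟩, h⟩ | h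
  · exact (Φ.ne_zero' i h).elim
  · exact Or.inl ⟨Φ.coroot.injective hji ▸ hj, h⟩
  · exact Or.inr h

theorem StrictlyDominant.coroot'_ne_zero {v : V} (hv : StrictlyDominant b v) (i : ι) :
    Φ.coroot' i v ≠ 0 := by
  have hpos : ∀ j, b.IsPos j → 0 < Φ.coroot' j v := by
    intro j hj
    have hne : b.support.Nonempty := by
      have : Nonempty ι := ⟨j⟩
      exact b.support_nonempty
    -- The smallest value on a simple coroot serves as the uniform bound `c`.
    obtain ⟨k, hk, hmin⟩ := b.support.exists_min_image (fun k => Φ.coroot' k v) hne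
    rcases le_coroot'_of_isPos (hv k hk).le hmin hj with ⟨-, h⟩ | h <;> linarith [hv k hk]
  let := Φ.indexNeg
  rcases RootPairing.Base.IsPos.or_neg b i with h | h
  · exact (hpos i h).ne'
  · have h' := hpos _ h
    have : Φ.coroot' (-i) v = - Φ.coroot' i v := by
      simp [RootPairing.coroot']
    rw [this] at h'
    intro h0
    simp [h0] at h'

variable [Φ.IsCrystallographic] [Φ.IsReduced]

/-- Averaging `v - w • v` over the Weyl group gives `v`: the orbit sum is fixed by all reflections,
hence orthogonal to all coroots, hence zero. -/
theorem Dominant.inRootCone {v : V} (hv : Dominant b v) : InRootCone b v := by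
  have := finite_weylGroup (Φ := Φ)
  cases nonempty_fintype Φ.weylGroup
  have hfix : ∑ w : Φ.weylGroup, w • v = 0 := by
    have h : ∀ g : Φ.weylGroup, g • ∑ w : Φ.weylGroup, w • v = ∑ w : Φ.weylGroup, w • v := by
      intro g
      rw [Finset.smul_sum]
      exact Fintype.sum_equiv (Equiv.mulLeft g) _ _ fun w => (mul_smul g w v).symm
    rw [← sum_coroot'_smul_fundamentalWeight b (∑ w : Φ.weylGroup, w • v)]
    refine Finset.sum_eq_zero fun i _ => ?_
    have hi := h (weylGroup.ofIdx Φ i)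
    rw [ofIdx_smul_eq, sub_eq_self, smul_eq_zero_iff_left (Φ.ne_zero i)] at hi
    rw [hi, zero_smul]
  have hsum : InRootCone b (∑ w : Φ.weylGroup, (v - w • v)) :=
    InRootCone.sum fun w _ => hv.inRootCone_sub_smul w
  rw [Finset.sum_sub_distrib, hfix, sub_zero, Finset.sum_const, Finset.card_univ,
    ← Nat.cast_smul_eq_nsmul ℝ] at hsum
  have hc : (0 : ℝ) < Fintype.card Φ.weylGroup := by exact_mod_cast Fintype.card_pos
  have := hsum.smul (inv_nonneg.mpr hc.le)
  rwa [smul_smul, inv_mul_cancel₀ hc.ne', one_smul] at this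

/-! ### Weights dominated by a given one -/

/-- The set of vectors whose Weyl group orbit lies below `μ` in the order defined by the cone
spanned by the simple roots. -/
def dominatedSet (b : Φ.Base) (μ : V) : Set V :=
  {u | ∀ w : Φ.weylGroup, InRootCone b (μ - w • u)}

omit [Finite ι] [Φ.IsCrystallographic] [Φ.IsReduced] in
theorem smul_mem_dominatedSet {μ u : V} (hu : u ∈ dominatedSet b μ) (w : Φ.weylGroup) :
    w • u ∈ dominatedSet b μ := fun w' => by
  rw [← mul_smul]
  exact hu _

theorem Dominant.permutohedron_subset_dominatedSet {μ : V} (hμ : Dominant b μ) :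
    permutohedron Φ μ ⊆ dominatedSet b μ := by
  refine convexHull_min ?_ ?_
  · rintro _ ⟨w, rfl⟩ w'
    change InRootCone b (μ - w' • w • μ)
    rw [← mul_smul]
    exact hμ.inRootCone_sub_smul _
  · intro x hx y hy s t hs ht hst w
    have h := ((hx w).smul hs).add ((hy w).smul ht)
    convert h using 1
    rw [smul_add, smul_comm w s, smul_comm w t, smul_sub, smul_sub]
    nth_rw 1 [← one_smul ℝ μ]
    rw [← hst, add_smul]
    abel

theorem exists_linearMap_lt_of_notMem_convexHull {E : Type*} [AddCommGroup E] [Module ℝ E]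
    [FiniteDimensional ℝ E] {s : Set E} (hs : s.Finite) {x : E} (hx : x ∉ convexHull ℝ s) :
    ∃ f : E →ₗ[ℝ] ℝ, ∀ y ∈ s, f y < f x := by
  let e : E ≃ₗ[ℝ] (Fin (Module.finrank ℝ E) → ℝ) := (Module.finBasis ℝ E).equivFun
  have hx' : e x ∉ convexHull ℝ (e '' s) := by
    rw [← LinearEquiv.coe_coe, ← LinearMap.image_convexHull]
    rintro ⟨y, hy, hyx⟩
    exact hx (e.injective hyx ▸ hy)
  obtain ⟨f, c, h₁, h₂⟩ := geometric_hahn_banach_closed_point (convex_convexHull ℝ (e '' s))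
    ((hs.image e).isClosed_convexHull ℝ) hx'
  exact ⟨(f : (Fin (Module.finrank ℝ E) → ℝ) →ₗ[ℝ] ℝ).comp e.toLinearMap, fun y hy =>
    (h₁ _ (subset_convexHull ℝ _ ⟨y, hy, rfl⟩)).trans h₂⟩

/-- Otherwise a functional `f` is strictly larger at `u` than on the orbit of `μ`. For `w` making `f
∘ w` nonnegative on simple roots, `f (w • μ) ≥ f (w • u) ≥ f u`, a contradiction. -/
theorem Dominant.mem_permutohedron {u μ : V} (hu : Dominant b u) (h : InRootCone b (μ - u)) :
    u ∈ permutohedron Φ μ := by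
  have := finite_weylGroup (Φ := Φ)
  have : FiniteDimensional ℝ V := Module.Basis.finiteDimensional_of_finite b.toWeightBasis
  by_contra hnot
  obtain ⟨f, hf⟩ := exists_linearMap_lt_of_notMem_convexHull
    (s := MulAction.orbit Φ.weylGroup μ) (Set.finite_range _) hnot
  obtain ⟨w, hw⟩ := exists_forall_nonneg_apply_smul_root b f
  have h₁ := h.map_nonneg (f ∘ₗ weylMap w) hw
  have h₂ := (hu.inRootCone_sub_smul w⁻¹).map_nonneg (f ∘ₗ weylMap w) hw
  have h₃ := hf (w • μ) ⟨w, rfl⟩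
  simp only [LinearMap.comp_apply, DistribSMul.toLinearMap_apply, smul_inv_smul,
    map_sub] at h₁ h₂
  linarith

end CentralFiring

namespace CentralFiring

open RootPairing

variable {ι V N : Type*} [AddCommGroup V] [Module ℝ V] [AddCommGroup N] [Module ℝ N]
variable {Φ : RootPairing ι ℝ V N}

/-! ### Lattices -/

theorem root_mem_rootLattice (i : ι) : Φ.root i ∈ rootLattice Φ :=
  AddSubgroup.subset_closure ⟨i, rfl⟩

theorem rootLattice_le_weightLattice [Φ.IsCrystallographic] :
    rootLattice Φ ≤ weightLattice Φ := by
  refine (AddSubgroup.closure_le _).mpr ?_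
  rintro _ ⟨i, rfl⟩ j
  refine ⟨Φ.pairingIn ℤ i j, ?_⟩
  rw [RootPairing.root_coroot'_eq_pairing, ← Φ.algebraMap_pairingIn ℤ]
  rfl

theorem sub_smul_mem_rootLattice (w : Φ.weylGroup) :
    ∀ {v : V}, v ∈ weightLattice Φ → v - w • v ∈ rootLattice Φ := by
  obtain ⟨w, hw⟩ := w
  induction hw using RootPairing.weylGroup.induction with
  | mem i =>
    intro v hv
    change v - weylGroup.ofIdx Φ i • v ∈ _
    obtain ⟨n, hn⟩ := hv i
    rw [ofIdx_smul_eq, sub_sub_cancel, hn, Int.cast_smul_eq_zsmul]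
    exact AddSubgroup.zsmul_mem _ (root_mem_rootLattice i) n
  | one =>
    intro v _
    change v - v ∈ rootLattice Φ
    rw [sub_self]
    exact zero_mem _
  | mul x y hx hy ihx ihy =>
    intro v hv
    have h₁ := ihy hv
    have h₂ := ihx (smul_mem_weightLattice Φ ⟨y, hy⟩ hv)
    have := add_mem h₁ h₂
    rwa [sub_add_sub_cancel] at this

theorem exists_int_repr_eq [Φ.IsRootSystem] (b : Φ.Base) {v : V} (hv : v ∈ rootLattice Φ)
    (i : b.support) : ∃ n : ℤ, b.toWeightBasis.repr v i = n := by
  classical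
  induction hv using AddSubgroup.closure_induction with
  | mem x hx =>
    obtain ⟨j, rfl⟩ := hx
    obtain ⟨f, -, -, hf⟩ := b.exists_root_eq_sum_int j
    refine ⟨f i, ?_⟩
    rw [hf, ← Finset.sum_coe_sort]
    simp only [← Int.cast_smul_eq_zsmul ℝ, map_sum, map_smul,
      Finsupp.coe_finsetSum, Finset.sum_apply, Finsupp.smul_apply,
      RootPairing.Base.toWeightBasis_repr_root, Finsupp.single_apply, smul_eq_mul,
      mul_ite, mul_one, mul_zero, Finset.sum_ite_eq', Finset.mem_univ, if_true]
  | zero => exact ⟨0, by simp⟩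
  | add x y _ _ hx hy =>
    obtain ⟨m, hm⟩ := hx
    obtain ⟨n, hn⟩ := hy
    exact ⟨m + n, by simp [hm, hn]⟩
  | neg x _ hx =>
    obtain ⟨m, hm⟩ := hx
    exact ⟨-m, by simp [hm]⟩

/-! ### Permutohedra as traps -/

variable [Finite ι] [Φ.IsRootSystem] {b : Φ.Base}

/-- If `u` is dominated by `μ` and orthogonal to a root `β` in whose support the simple root `i`
occurs, then the `i`-th coefficient of `μ - u` is bounded below. -/
theorem exists_le_repr_sub {μ u : V} (hu : u ∈ dominatedSet b μ)
    {β : ι} (hβ : Φ.coroot' β u = 0) (i : b.support) :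
    ∃ (w : Φ.weylGroup) (κ : ι), b.IsPos κ ∧ w • κ = β ∧
      b.toWeightBasis.repr (μ - w • μ) i +
        b.toWeightBasis.repr (Φ.root β) i / 2 * Φ.coroot' κ μ ≤
      b.toWeightBasis.repr (μ - u) i := by
  set p : ℝ := b.toWeightBasis.repr (Φ.root β) i with hp
  -- The multiple of the coroot is chosen so that `f` is invariant under the reflection in `β`;
  -- since `u` is orthogonal to `β`, `f u` is still the `i`-th coefficient of `u`.
  let f : V →ₗ[ℝ] ℝ := b.toWeightBasis.coord i - (p / 2) • Φ.coroot' β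
  have hf : ∀ v, f v = b.toWeightBasis.repr v i - p / 2 * Φ.coroot' β v := fun v => rfl
  have hfβ : ∀ v, f (weylGroup.ofIdx Φ β • v) = f v := by
    intro v
    have h2 : Φ.coroot' β (Φ.root β) = 2 := by
      rw [RootPairing.root_coroot'_eq_pairing, RootPairing.pairing_same]
    rw [hf, hf, ofIdx_smul_eq]
    simp only [map_sub, map_smul, Finsupp.sub_apply, Finsupp.smul_apply, smul_eq_mul, h2, ← hp]
    ring
  have aux : ∀ w : Φ.weylGroup, (∀ j ∈ b.support, 0 ≤ f (w • Φ.root j)) →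
      b.toWeightBasis.repr (μ - w • μ) i + p / 2 * Φ.coroot' (w⁻¹ • β) μ ≤
        b.toWeightBasis.repr (μ - u) i := by
    intro w hw
    have h := (hu w⁻¹).map_nonneg (f ∘ₗ weylMap w) hw
    simp only [LinearMap.comp_apply, DistribSMul.toLinearMap_apply, smul_inv_smul,
      map_sub, hf, hβ, coroot'_smul_right] at h
    simp only [map_sub, Finsupp.sub_apply]
    linarith
  obtain ⟨w, hw⟩ := exists_forall_nonneg_apply_smul_root b f
  let := Φ.indexNeg
  rcases RootPairing.Base.IsPos.or_neg b (w⁻¹ • β) with h | h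
  · exact ⟨w, w⁻¹ • β, h, smul_inv_smul w β, aux w hw⟩
  · have hinv : (weylGroup.ofIdx Φ β * w)⁻¹ • β = -(w⁻¹ • β) := by
      rw [inv_smul_eq_iff, mul_smul]
      apply Φ.root.injective
      rw [root_weylGroup_smul, root_weylGroup_smul, RootPairing.indexNeg_neg,
        RootPairing.root_reflectionPerm, RootPairing.reflection_apply_self,
        root_weylGroup_smul, smul_neg, smul_inv_smul, smul_neg, ofIdx_smul_eq,
        RootPairing.root_coroot'_eq_pairing, RootPairing.pairing_same, two_smul]
      abel
    refine ⟨weylGroup.ofIdx Φ β * w, _, h, ?_, ?_⟩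
    · rw [← hinv, smul_inv_smul]
    · rw [← hinv]
      refine aux _ fun j hj => ?_
      rw [mul_smul, hfβ]
      exact hw j hj

variable [Φ.IsCrystallographic] [Φ.IsReduced]

/-- With values at least 2, the estimate gives at least the full coefficient of the root being
added. No integrality is used, so `μ` need not be a weight; this is the trap for termination. -/
theorem add_root_mem_dominatedSet_of_two_le {μ u : V} (hμ : ∀ i ∈ b.support, 2 ≤ Φ.coroot' i μ)
    (hu : u ∈ dominatedSet b μ) {α : ι} (hα : Φ.coroot' α u = 0) :
    u + Φ.root α ∈ dominatedSet b μ := by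
  intro w i
  by_contra! hneg
  have hu' := smul_mem_dominatedSet hu w
  have hα' : Φ.coroot' (w • α) (w • u) = 0 := by rw [coroot'_weylGroup_smul, hα]
  obtain ⟨w', κ, hκ, -, h⟩ := exists_le_repr_sub hu' hα' i
  have hdom : Dominant b μ := fun j hj => zero_le_two.trans (hμ j hj)
  have h₁ := hdom.inRootCone_sub_smul w' i
  have h₂ := hu w i
  have h₃ : 2 ≤ Φ.coroot' κ μ := by
    rcases le_coroot'_of_isPos zero_le_two hμ hκ with ⟨-, h⟩ | h <;> linarith
  rw [smul_add, ← root_weylGroup_smul, ← sub_sub, map_sub, Finsupp.sub_apply] at hneg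
  have hp : 0 < b.toWeightBasis.repr (Φ.root (w • α)) i := by linarith
  nlinarith

/-- In a root system of type `G₂` the coefficients of the roots are at most `3`. -/
theorem repr_root_le_three [Φ.IsIrreducible] {j k : ι} (hj : j ∈ b.support) (hk : k ∈ b.support)
    (hjk : Φ.pairingIn ℤ j k = -3) (β : ι) (i : b.support) :
    b.toWeightBasis.repr (Φ.root β) i ≤ 3 := by
  classical
  let _G : Φ.EmbeddedG2 := { long := j, short := k, pairingIn_long_short := hjk }
  have hjk' : j ≠ k := by
    rintro rfl
    simp at hjk
  have h := EmbeddedG2.mem_allRoots Φ β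
  have hl : EmbeddedG2.longRoot Φ = Φ.root j := rfl
  have hs : EmbeddedG2.shortRoot Φ = Φ.root k := rfl
  have hj' := b.toWeightBasis_repr_root ⟨j, hj⟩
  have hk' := b.toWeightBasis_repr_root ⟨k, hk⟩
  simp only at hj' hk'
  -- The simple root `i` is `j`, is `k`, or is neither, and every root is an explicit combination of
  -- those at `j` and `k`.
  have hx : b.toWeightBasis.repr (Φ.root j) i = 1 ∧ b.toWeightBasis.repr (Φ.root k) i = 0 ∨
      b.toWeightBasis.repr (Φ.root j) i = 0 ∧
        (b.toWeightBasis.repr (Φ.root k) i = 1 ∨ b.toWeightBasis.repr (Φ.root k) i = 0) := by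
    rw [hj', hk', Finsupp.single_apply, Finsupp.single_apply]
    split_ifs with h₁ h₂
    · exact (hjk' (congrArg Subtype.val (h₁.trans h₂.symm))).elim
    all_goals simp
  simp only [List.mem_cons, List.not_mem_nil, or_false, EmbeddedG2.shortAddLongRoot_eq,
    EmbeddedG2.twoShortAddLongRoot_eq, EmbeddedG2.threeShortAddLongRoot_eq,
    EmbeddedG2.threeShortAddTwoLongRoot_eq, hl, hs] at h
  rcases h with h | h | h | h | h | h | h | h | h | h | h | h <;>
    simp only [h, map_add, map_neg, map_smul, Finsupp.add_apply, Finsupp.neg_apply,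
      Finsupp.smul_apply, smul_eq_mul] <;>
    rcases hx with ⟨hx₁, hx₂⟩ | ⟨hx₁, hx₂ | hx₂⟩ <;> linarith

omit [Φ.IsRootSystem] in
theorem neg_three_le_pairingIn (i j : ι) : -3 ≤ Φ.pairingIn ℤ i j := by
  have := Φ.pairingIn_pairingIn_mem_set_of_isCrystal_of_isRed i j
  simp only [Set.mem_insert_iff, Set.mem_singleton_iff, Prod.mk.injEq] at this
  omega

/-- A positive coroot that is not simple takes a value at least 2 on `μ`, and the previous argument
applies. If `κ` is simple, a failure by at least 1 makes `∑ c k` small, whereas `w'` moving the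
simple root `κ` to a root with coefficient `p` forces it to be large. -/
theorem add_root_mem_dominatedSet [Φ.IsIrreducible] {μ u : V} (hμ : StrictlyDominant b μ)
    (hμP : μ ∈ weightLattice Φ) (hu : u ∈ dominatedSet b μ) (huμ : μ - u ∈ rootLattice Φ)
    {α : ι} (hα : Φ.coroot' α u = 0) :
    u + Φ.root α ∈ dominatedSet b μ := by
  classical
  have hμ1 : ∀ j ∈ b.support, 1 ≤ Φ.coroot' j μ := by
    intro j hj
    obtain ⟨n, hn⟩ := hμP j
    have := hμ j hj
    rw [hn] at this ⊢
    exact_mod_cast this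
  have huP : u ∈ weightLattice Φ := by
    have := sub_mem hμP (rootLattice_le_weightLattice huμ)
    rwa [sub_sub_cancel] at this
  intro w i
  by_contra! hneg
  have hu' := smul_mem_dominatedSet hu w
  have hα' : Φ.coroot' (w • α) (w • u) = 0 := by rw [coroot'_weylGroup_smul, hα]
  have hle : b.toWeightBasis.repr (μ - w • (u + Φ.root α)) i ≤ -1 := by
    have hmem : μ - w • (u + Φ.root α) ∈ rootLattice Φ := by
      have := sub_mem (add_mem huμ (sub_smul_mem_rootLattice w huP))
        (root_mem_rootLattice (w • α))
      convert this using 1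
      rw [smul_add, root_weylGroup_smul]
      abel
    obtain ⟨n, hn⟩ := exists_int_repr_eq b hmem i
    rw [hn] at hneg ⊢
    have : n < 0 := by exact_mod_cast hneg
    exact_mod_cast (by omega : n ≤ -1)
  obtain ⟨w', κ, hκ, hκβ, h⟩ := exists_le_repr_sub hu' hα' i
  have h₁ := hμ.dominant.inRootCone_sub_smul w' i
  have h₂ := hu w i
  rw [smul_add, ← root_weylGroup_smul, ← sub_sub, map_sub, Finsupp.sub_apply] at hle
  set p : ℝ := b.toWeightBasis.repr (Φ.root (w • α)) i with hp
  have hp1 : 1 ≤ p := by linarith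
  rcases le_coroot'_of_isPos zero_le_one hμ1 hκ with ⟨hκs, hκ1⟩ | hκ2
  swap
  · nlinarith
  -- Coefficients measuring how far `w'` moves each fundamental weight; any `v - w' • v` has `i`-th
  -- coefficient linear in them.
  let c : b.support → ℝ := fun k =>
    b.toWeightBasis.repr (fundamentalWeight b k - w' • fundamentalWeight b k) i
  have hc : ∀ k, 0 ≤ c k := fun k => (dominant_fundamentalWeight b k).inRootCone_sub_smul w' i
  have hexp : ∀ v : V, b.toWeightBasis.repr (v - w' • v) i =
      ∑ k : b.support, Φ.coroot' k v * c k := by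
    intro v
    let g : V →ₗ[ℝ] ℝ := b.toWeightBasis.coord i ∘ₗ (LinearMap.id - weylMap w')
    change g v = ∑ k : b.support, Φ.coroot' k v * g (fundamentalWeight b k)
    conv_lhs => rw [← sum_coroot'_smul_fundamentalWeight b v]
    simp only [map_sum, map_smul, smul_eq_mul]
  have hsum : ∑ k, c k ≤ p / 2 - 1 := by
    have h₃ : ∑ k, c k ≤ b.toWeightBasis.repr (μ - w' • μ) i := by
      rw [hexp]
      exact Finset.sum_le_sum fun k _ => le_mul_of_one_le_left (hc k) (hμ1 k k.2)
    nlinarith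
  have hβ : b.toWeightBasis.repr (Φ.root κ - w' • Φ.root κ) i ≤ 1 - p := by
    rw [← root_weylGroup_smul, hκβ, map_sub, Finsupp.sub_apply, ← hp,
      b.toWeightBasis_repr_root ⟨κ, hκs⟩, Finsupp.single_apply]
    split_ifs <;> linarith
  rw [hexp] at hβ
  have hpair : ∀ k : b.support, Φ.coroot' k (Φ.root κ) = (Φ.pairingIn ℤ κ k : ℝ) := by
    intro k
    rw [RootPairing.root_coroot'_eq_pairing, ← Φ.algebraMap_pairingIn ℤ]
    rfl
  have hbound : ∀ m : ℝ, (∀ k : b.support, -m ≤ Φ.coroot' k (Φ.root κ)) →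
      -m * ∑ k, c k ≤ 1 - p := by
    intro m hm
    rw [Finset.mul_sum]
    exact (Finset.sum_le_sum fun k _ => mul_le_mul_of_nonneg_right (hm k) (hc k)).trans hβ
  -- Without a pairing `-3`, `(p - 1) / 2 ≤ ∑ c k ≤ p / 2 - 1` is absurd. With one, `(p - 1) / 3 ≤ p
  -- / 2 - 1` forces `p ≥ 4`, against the bound 3 in `G₂`.
  by_cases hG : ∃ k ∈ b.support, Φ.pairingIn ℤ κ k = -3
  · obtain ⟨k, hk, hκk⟩ := hG
    have hp3 : p ≤ 3 := repr_root_le_three hκs hk hκk _ i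
    have := hbound 3 fun k => by
      rw [hpair]
      exact_mod_cast neg_three_le_pairingIn κ k
    linarith
  · push Not at hG
    have := hbound 2 fun k => by
      rw [hpair]
      have h₃ := neg_three_le_pairingIn (Φ := Φ) κ k
      have h₄ := hG k k.2
      exact_mod_cast (by omega : -2 ≤ Φ.pairingIn ℤ κ k)
    linarith

end CentralFiring

namespace CentralFiring

open RootPairing

/-! ### Stabilizations from traps -/

theorem Terminating.exists_stable {X : Type*} {r : X → X → Prop} (hr : Terminating r) (x : X) :
    ∃ y, Relation.ReflTransGen r x y ∧ Stable r y := by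
  by_contra! hno
  have hstep : ∀ y : {y // Relation.ReflTransGen r x y},
      ∃ z : {y // Relation.ReflTransGen r x y}, r y z := fun y => by
    obtain ⟨z, hz⟩ := not_not.mp (hno y y.2)
    exact ⟨⟨z, y.2.tail hz⟩, hz⟩
  choose g hg using hstep
  refine hr ⟨fun n => (g^[n] ⟨x, .refl⟩ : X), fun n => ?_⟩
  simp only [Function.iterate_succ_apply']
  exact hg _

/-- Every element reachable from `x` stays in the trap `S` and reaches some stable element,
necessarily `y`; so `y` itself joins any two branches. -/
theorem Terminating.isStabilization {X : Type*} {r : X → X → Prop} (hr : Terminating r)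
    {S : Set X} (hS : ∀ y ∈ S, ∀ z, r y z → z ∈ S) {x y : X} (hx : x ∈ S) (hy : Stable r y)
    (hSy : ∀ z ∈ S, Stable r z → z = y) : IsStabilization r x y := by
  have htrap : ∀ z, Relation.ReflTransGen r x z → z ∈ S := by
    intro z hz
    induction hz with
    | refl => exact hx
    | tail _ h ih => exact hS _ ih _ h
  have hreach : ∀ z, Relation.ReflTransGen r x z → Relation.ReflTransGen r z y := by
    intro z hz
    obtain ⟨u, hu, hu'⟩ := hr.exists_stable z
    rwa [← hSy u (htrap u (hz.trans hu)) hu']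
  exact
    { terminating := hr
      confluentFrom := fun z z' hz hz' => ⟨y, hreach z hz, hreach z' hz'⟩
      reachable := hreach x .refl
      stable := hy
      unique := fun z hz hz' => hSy z (htrap z hz) hz' }

variable {ι V N : Type*} [AddCommGroup V] [Module ℝ V] [AddCommGroup N] [Module ℝ N]
variable {Φ : RootPairing ι ℝ V N}

theorem weightOrbit_eq_iff {u v : weightLattice Φ} :
    weightOrbit u = weightOrbit v ↔ ∃ w : Φ.weylGroup, (u : V) = w • (v : V) := by
  refine Quotient.eq.trans ⟨?_, ?_⟩
  · rintro ⟨w, hw⟩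
    exact ⟨w, (congrArg Subtype.val hw).symm⟩
  · rintro ⟨w, hw⟩
    exact ⟨w, Subtype.ext hw.symm⟩

variable [Finite ι] [Φ.IsRootSystem] [Φ.IsCrystallographic] [Φ.IsReduced] {b : Φ.Base}

/-! ### Termination -/

theorem exists_mem_dominatedSet (b : Φ.Base) (v : V) :
    ∃ μ : V, (∀ i ∈ b.support, 2 ≤ Φ.coroot' i μ) ∧ v ∈ dominatedSet b μ := by
  cases nonempty_fintype ι
  set M : ℝ := ∑ i, |Φ.coroot' i v| with hM
  have hM0 : 0 ≤ M := Finset.sum_nonneg fun i _ => abs_nonneg _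
  have hMi : ∀ i, Φ.coroot' i v ≤ M := fun i => (le_abs_self _).trans
    (Finset.single_le_sum (f := fun i => |Φ.coroot' i v|) (fun _ _ => abs_nonneg _)
      (Finset.mem_univ i))
  -- `M` bounds the values of all `w • v` on coroots, so the difference is dominant and hence in the
  -- cone; the extra 2 gives the bound on simple coroots.
  refine ⟨(M + 2) • weylVector b, fun i hi => ?_, fun w => Dominant.inRootCone fun i hi => ?_⟩
  · rw [map_smul, coroot'_weylVector b hi, smul_eq_mul]
    linarith
  · rw [map_sub, map_smul, coroot'_weylVector b hi, smul_eq_mul, coroot'_smul_right]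
    linarith [hMi (w⁻¹ • i)]

theorem terminating_unlabeledCentralFires (b : Φ.Base) :
    Terminating (UnlabeledCentralFires b) := by
  cases nonempty_fintype ι
  rintro ⟨x, hx⟩
  obtain ⟨v₀, hv₀⟩ := Quotient.exists_rep (x 0)
  obtain ⟨μ, hμ, hv₀μ⟩ := exists_mem_dominatedSet b (v₀ : V)
  have key : ∀ n : ℕ, ∃ v : weightLattice Φ, weightOrbit v = x n ∧ (v : V) ∈ dominatedSet b μ ∧
      4 * (n : ℝ) ≤ Φ.RootForm (v : V) (v : V) := by
    intro n
    induction n with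
    | zero =>
      refine ⟨v₀, hv₀, hv₀μ, ?_⟩
      rw [RootPairing.rootForm_apply_apply]
      simpa using Finset.sum_nonneg fun i _ => mul_self_nonneg (Φ.coroot' i (v₀ : V))
    | succ n ih =>
      obtain ⟨v, hv, hvμ, hvn⟩ := ih
      obtain ⟨u, u', hu, hu', α, -, hα, huα⟩ := hx n
      obtain ⟨w, hw⟩ := weightOrbit_eq_iff.mp (hu.trans hv.symm)
      refine ⟨u', hu', ?_, ?_⟩
      · rw [huα]
        exact add_root_mem_dominatedSet_of_two_le hμ (hw ▸ smul_mem_dominatedSet hvμ w) hα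
      · have h₁ := two_mul_rootForm_root (Φ := Φ) (u : V) α
        rw [hα, zero_mul] at h₁
        have h₂ := four_le_rootForm_root_self (Φ := Φ) α
        have h₃ : Φ.RootForm (u : V) (u : V) = Φ.RootForm (v : V) (v : V) := by
          rw [hw, rootForm_weylGroup_smul]
        rw [huα]
        simp only [map_add, LinearMap.add_apply, rootForm_comm (Φ.root α) (u : V)]
        push_cast
        linarith
  obtain ⟨n, hn⟩ := exists_nat_gt (Φ.RootForm μ μ)
  obtain ⟨v, -, hvμ, hvn⟩ := key n
  obtain ⟨w, hw⟩ := exists_dominant_smul b (v : V)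
  have h := hw.rootForm_self_le (fun i hi => zero_le_two.trans (hμ i hi)) (hvμ w)
  rw [rootForm_weylGroup_smul] at h
  have : (0 : ℝ) ≤ n := n.cast_nonneg
  linarith

/-! ### Stable orbits -/

omit [Φ.IsCrystallographic] [Φ.IsReduced] in
theorem stable_weightOrbit {μ : weightLattice Φ} (hμ : StrictlyDominant b (μ : V)) :
    Stable (UnlabeledCentralFires b) (weightOrbit μ) := by
  rintro ⟨_, u, _, hu, -, α, -, hα, -⟩
  obtain ⟨w, hw⟩ := weightOrbit_eq_iff.mp hu
  rw [hw, coroot'_smul_right] at hα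
  exact hμ.coroot'_ne_zero _ hα

omit [Φ.IsReduced] in
-- If the dominant representative were orthogonal to a simple root, that root could be fired.
theorem Stable.exists_strictlyDominant {v : weightLattice Φ}
    (hv : Stable (UnlabeledCentralFires b) (weightOrbit v)) :
    ∃ w : Φ.weylGroup, StrictlyDominant b (w • (v : V)) := by
  obtain ⟨w, hw⟩ := exists_dominant_smul b (v : V)
  refine ⟨w, fun i hi => (hw i hi).lt_of_ne fun h0 => hv ?_⟩
  let u : weightLattice Φ := ⟨w • (v : V), smul_mem_weightLattice Φ w v.2⟩
  let u' : weightLattice Φ :=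
    ⟨w • (v : V) + Φ.root i, add_mem u.2 (rootLattice_le_weightLattice (root_mem_rootLattice i))⟩
  exact ⟨weightOrbit u', u, u', weightOrbit_eq_iff.mpr ⟨w, rfl⟩, rfl, i,
    RootPairing.Base.isPos_of_mem_support hi, h0.symm, rfl⟩

/-- The property defining minuscule weights, which is shared by the zero weight. -/
structure MinusculeOrZero (b : Φ.Base) (ω : V) : Prop where
  mem_weightLattice : ω ∈ weightLattice Φ
  dominant : Dominant b ω
  latticePoints_subset : latticePoints Φ ω ⊆ MulAction.orbit Φ.weylGroup ω

omit [Finite ι] [Φ.IsRootSystem] [Φ.IsCrystallographic] [Φ.IsReduced] in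
theorem minusculeOrZero_zero (b : Φ.Base) : MinusculeOrZero b 0 where
  mem_weightLattice := zero_mem _
  dominant i _ := by simp
  latticePoints_subset := by
    have h : MulAction.orbit Φ.weylGroup (0 : V) = {0} := by
      refine Set.eq_singleton_iff_unique_mem.mpr ⟨MulAction.mem_orbit_self 0, ?_⟩
      rintro _ ⟨w, rfl⟩
      exact smul_zero w
    rintro u ⟨hu, -⟩
    rwa [permutohedron, h, convexHull_singleton, ← h] at hu

omit [Finite ι] [Φ.IsRootSystem] [Φ.IsCrystallographic] [Φ.IsReduced] in
theorem Minuscule.minusculeOrZero {ω : V} (hω : Minuscule b ω) : MinusculeOrZero b ω where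
  mem_weightLattice := hω.mem_weightLattice
  dominant := hω.dominant
  latticePoints_subset := hω.latticePoints_eq.subset

/-! ### The weight `ρ + ω` for `ω` zero or minuscule -/

namespace MinusculeOrZero

variable {ω : V} (hω : MinusculeOrZero b ω)
include hω

omit [Finite ι] [Φ.IsCrystallographic] [Φ.IsReduced] in
theorem strictlyDominant : StrictlyDominant b (weylVector b + ω) := fun i hi => by
  rw [map_add, coroot'_weylVector b hi]
  linarith [hω.dominant i hi]

theorem eq_of_strictlyDominant {v : V} (hv : StrictlyDominant b v)
    (hle : InRootCone b (weylVector b + ω - v)) (hvQ : weylVector b + ω - v ∈ rootLattice Φ) :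
    v = weylVector b + ω := by
  have hvP : v ∈ weightLattice Φ := by
    have := sub_mem (add_mem (weylVector_mem_weightLattice b) hω.mem_weightLattice)
      (rootLattice_le_weightLattice hvQ)
    rwa [sub_sub_cancel] at this
  have hdom : Dominant b (v - weylVector b) := by
    intro i hi
    obtain ⟨n, hn⟩ := hvP i
    have h := hv i hi
    rw [hn] at h
    have : (1 : ℝ) ≤ n := by exact_mod_cast h
    rw [map_sub, coroot'_weylVector b hi, hn]
    linarith
  have heq : weylVector b + ω - v = ω - (v - weylVector b) := by abel
  rw [heq] at hle hvQ
  obtain ⟨w, hw⟩ := hω.latticePoints_subset ⟨hdom.mem_permutohedron hle, hvQ⟩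
  simp only at hw
  -- Two dominant vectors in one orbit each dominate the other, hence coincide.
  have h := hdom.inRootCone_sub_smul w⁻¹
  rw [← hw, inv_smul_smul, hw] at h
  rw [← eq_of_inRootCone_sub h hle]
  abel

theorem isStabilization [Φ.IsIrreducible] {v : weightLattice Φ}
    (hv : (v : V) ∈ latticePoints Φ (weylVector b + ω)) {μ : weightLattice Φ}
    (hμ : (μ : V) = weylVector b + ω) :
    IsStabilization (UnlabeledCentralFires b) (weightOrbit v) (weightOrbit μ) := by
  have hμs : StrictlyDominant b (μ : V) := hμ ▸ hω.strictlyDominant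
  rw [← hμ] at hv
  -- Domination and the root-lattice coset are invariant under the Weyl group, so the trap may be
  -- tested on any representative.
  let S : Set (WeightOrbits Φ) := {A | ∃ u : weightLattice Φ, weightOrbit u = A ∧
    (u : V) ∈ dominatedSet b (μ : V) ∧ (μ : V) - u ∈ rootLattice Φ}
  have hsmul : ∀ {u u' : weightLattice Φ} {w : Φ.weylGroup}, (u' : V) = w • (u : V) →
      (μ : V) - u ∈ rootLattice Φ → (μ : V) - u' ∈ rootLattice Φ := by
    intro u u' w hw hu
    have := add_mem hu (sub_smul_mem_rootLattice w u.2)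
    rwa [sub_add_sub_cancel, ← hw] at this
  refine (terminating_unlabeledCentralFires b).isStabilization (S := S) ?_
    ⟨v, rfl, hμs.dominant.permutohedron_subset_dominatedSet hv.1, hv.2⟩
    (stable_weightOrbit hμs) ?_
  · rintro _ ⟨u, rfl, huμ, huQ⟩ B ⟨u₁, u₂, hu₁, hu₂, α, -, hα, huα⟩
    obtain ⟨w, hw⟩ := weightOrbit_eq_iff.mp hu₁
    have hQ := hsmul hw huQ
    refine ⟨u₂, hu₂, ?_, ?_⟩
    · rw [huα]
      exact add_root_mem_dominatedSet hμs μ.2 (hw ▸ smul_mem_dominatedSet huμ w) hQ hα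
    · rw [huα, ← sub_sub]
      exact sub_mem hQ (root_mem_rootLattice α)
  · rintro _ ⟨u, rfl, huμ, huQ⟩ hst
    obtain ⟨w, hw⟩ := hst.exists_strictlyDominant
    have hQ := add_mem huQ (sub_smul_mem_rootLattice w u.2)
    rw [sub_add_sub_cancel] at hQ
    have hle := huμ w
    rw [hμ] at hQ hle
    exact (weightOrbit_eq_iff.mpr ⟨w, hμ.trans (hω.eq_of_strictlyDominant hw hle hQ).symm⟩).symm

end MinusculeOrZero

end CentralFiring

theorem mainTheorem4 {ι V N : Type*} [Finite ι] [AddCommGroup V] [Module ℝ V]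
    [AddCommGroup N] [Module ℝ N] (Φ : RootPairing ι ℝ V N) [Φ.IsRootSystem]
    [Φ.IsCrystallographic] [Φ.IsReduced] [Φ.IsIrreducible] (b : Φ.Base)
    (ω : CentralFiring.weightLattice Φ)
    (hω : ω = 0 ∨ CentralFiring.Minuscule b (ω : V)) :
    (∀ v : CentralFiring.weightLattice Φ,
      (v : V) ∈ CentralFiring.latticePoints Φ (CentralFiring.rho b + ω : V) →
        CentralFiring.IsStabilization (CentralFiring.UnlabeledCentralFires b)
          (CentralFiring.weightOrbit v)
          (CentralFiring.weightOrbit (CentralFiring.rho b + ω))) ∧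
    {v : V | v ∈ CentralFiring.latticePoints Φ (CentralFiring.rho b + ω : V) ∧
        CentralFiring.StrictlyDominant b v} = {(CentralFiring.rho b + ω : V)} := by
  have hω' : CentralFiring.MinusculeOrZero b (ω : V) := by
    rcases hω with rfl | hω
    · exact CentralFiring.minusculeOrZero_zero b
    · exact hω.minusculeOrZero
  refine ⟨fun v hv => hω'.isStabilization hv rfl, Set.eq_singleton_iff_unique_mem.mpr ⟨?_, ?_⟩⟩
  · refine ⟨⟨subset_convexHull ℝ _ (MulAction.mem_orbit_self _), ?_⟩, hω'.strictlyDominant⟩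
    rw [sub_self]
    exact zero_mem _
  · rintro v ⟨⟨hv, hvQ⟩, hvs⟩
    refine hω'.eq_of_strictlyDominant hvs ?_ hvQ
    simpa using hω'.strictlyDominant.dominant.permutohedron_subset_dominatedSet hv 1
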